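/- Let $K$ be a complex Hilbert space and $m\ge 0$. Let $X=(X_1,\dots,X_m)$ be a quantity with $m$ components: closable linear operators $X_j:D\to K$ (not necessarily bounded, Hermitian or commuting) on a common dense domain $D\subseteq K$. For $\xi\in\mathbb C^m$ let $X-\xi$ denote the closure of the operator $D\to K^m$, $\psi\mapsto(X_j\psi-\xi_j\psi)_j$, and let $|X-\xi|^2:=(X-\xi)^*(X-\xi)$, a positive self-adjoint operator on its natural domain. The spectrum $\operatorname{spec}X$ is the set of those $\xi\in\mathbb C^m$ for which there is no bounded linear operator $R$ on $K$ such that $R\,|X-\xi|^2$ is the identity on the domain of $|X-\xi|^2$. A state is a density operator $\rho$, i.e., a positive semidefinite bounded operator on $K$ with trace $1$. Write $\langle A\rangle=\operatorname{tr}A\rho$ and $\langle|X-\xi|^2\rangle=\|(X-\xi)\sqrt\rho\|_{\rm HS}^2$ (the squared Hilbert–Schmidt norm, equal to $\operatorname{tr}|X-\xi|^2\rho$ when the latter exists) whenever these are defined and finite. Let $\overline X=(\langle X_1\rangle,\dots,\langle X_m\rangle)$, with each $X_j$ replaced by its closure, and $\sigma_X=\langle|X-\overline X|^2\rangle^{1/2}$.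 Then for every $\xi\in\mathbb C^m$: 1. $\xi\in\operatorname{spec}X$ if and only if for every $\varepsilon>0$ there is a state in which $\langle|X-\xi|^2\rangle<\varepsilon$. 2. If $X$ is not the constant quantity $\xi$ (that is, if $X_j\psi\neq\xi_j\psi$ for some $j$ and some $\psi\in D$), then $\xi\in\operatorname{spec}X$ if and only if for every $\varepsilon>0$ there is a state in which $0<\langle|X-\xi|^2\rangle<\varepsilon$. 3. $\xi\in\operatorname{spec}X$ if and only if for every $\varepsilon>0$ there is a state with uncertainty $\sigma_X<\varepsilon$ and expectation value $|\overline X-\xi|<\varepsilon$ (Euclidean norm). That is, states in which $X$ has arbitrarily small uncertainty exist with expectation values arbitrarily close to $\xi$ exactly when $\xi$ is a spectral point. -/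

import Mathlib

open scoped ENNReal InnerProductSpace

noncomputable section

namespace QuantumSpectrum

universe u

/-- A scalar or vector quantity with `m` components: linear operators `X 0, …, X (m-1)` that are
defined on a common dense domain of the Hilbert space `K` and are closable (equivalently, have
densely defined adjoints). Neither boundedness, nor symmetry, nor commutativity is assumed. -/
structure Quantity (K : Type u) [NormedAddCommGroup K] [InnerProductSpace ℂ K] (m : ℕ) where
  domain : Submodule ℂ K
  dense_domain : Dense (domain : Set K)
  comp : Fin m → domain →ₗ[ℂ] K
  closable : ∀ j, (LinearPMap.mk domain (comp j)).IsClosable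

/-- A density operator: a positive semidefinite bounded operator of trace one (the sum of the
diagonal elements is one in every orthonormal basis). -/
structure DensityOperator (K : Type u) [NormedAddCommGroup K] [InnerProductSpace ℂ K] where
  op : K →L[ℂ] K
  pos : op.IsPositive
  trace_eq_one : ∀ (ι : Type u) (b : HilbertBasis ι ℂ K), HasSum (fun i => ⟪b i, op (b i)⟫_ℂ) 1

section Operators

variable {K : Type u} [NormedAddCommGroup K] [InnerProductSpace ℂ K] [CompleteSpace K]
variable {F : Type u} [NormedAddCommGroup F] [InnerProductSpace ℂ F] [CompleteSpace F]

/-- The operator `|A|² = A*A` for a (closed, densely defined) operator `A`, with its natural domain,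
the vectors `ψ` in the domain of `A` for which `A ψ` is in the domain of the adjoint of `A`. For
closed densely defined `A` this is a positive self-adjoint operator. -/
def absSq (A : K →ₗ.[ℂ] F) : K →ₗ.[ℂ] K where
  domain := (A.adjoint.domain.comap A.toFun).map A.domain.subtype
  toFun := A.adjoint.toFun ∘ₗ
    (A.toFun ∘ₗ Submodule.inclusion (Submodule.map_subtype_le A.domain _)).codRestrict
      A.adjoint.domain (by
        rintro ⟨_, ⟨y, hy, rfl⟩⟩
        exact hy)

/-- `⟨A⟩ = a` in the state `ρ`: the operator `A ρ` is defined on all of `K`, and its trace,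
calculated in any orthonormal basis, is `a`. -/
def HasExpectation (ρ : DensityOperator K) (A : K →ₗ.[ℂ] K) (a : ℂ) : Prop :=
  ∃ h : ∀ φ : K, ρ.op φ ∈ A.domain,
    ∀ (ι : Type u) (b : HilbertBasis ι ℂ K), HasSum (fun i => ⟪b i, A ⟨ρ.op (b i), h (b i)⟩⟫_ℂ) a

/-- `⟨|A|²⟩ = v` in the state `ρ`, for a closed operator `A`. Since `|A|²` is positive and possibly
unbounded, its expectation is the trace of `√ρ |A|² √ρ = (A √ρ)* (A √ρ)`, i.e. the squared
Hilbert–Schmidt norm of `A √ρ`. For a pure state `ρ = ψ ψ*` it is `‖A ψ‖²`. -/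
def HasAbsSqExpectation (ρ : DensityOperator K) (A : K →ₗ.[ℂ] F) (v : ℝ) : Prop :=
  ∃ h : ∀ φ : K, CFC.sqrt ρ.op φ ∈ A.domain,
    ∀ (ι : Type u) (b : HilbertBasis ι ℂ K),
      HasSum (fun i => ‖A ⟨CFC.sqrt ρ.op (b i), h (b i)⟩‖ ^ 2) v

end Operators

namespace Quantity

variable {K : Type u} [NormedAddCommGroup K] [InnerProductSpace ℂ K] {m : ℕ}

/-- The operator `X - ξ`, which maps `ψ` in the common domain to the column with entries
`X j ψ - ξ j ψ` in the Hilbert space `K ^ m`. -/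
def shift (X : Quantity K m) (ξ : EuclideanSpace ℂ (Fin m)) :
    K →ₗ.[ℂ] PiLp 2 (fun _ : Fin m => K) where
  domain := X.domain
  toFun := (WithLp.linearEquiv 2 ℂ (Fin m → K)).symm.toLinearMap ∘ₗ
    LinearMap.pi fun j => X.comp j - ξ j • X.domain.subtype

/-- The closure of `X - ξ`. -/
def closedShift (X : Quantity K m) (ξ : EuclideanSpace ℂ (Fin m)) :
    K →ₗ.[ℂ] PiLp 2 (fun _ : Fin m => K) :=
  (X.shift ξ).closure

/-- The closure of the component `X j`. -/
def closedComp (X : Quantity K m) (j : Fin m) : K →ₗ.[ℂ] K :=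
  (LinearPMap.mk X.domain (X.comp j)).closure

/-- The spectrum of `X`: the `ξ` for which there is no bounded linear operator `R` such that
`R |X - ξ|²` is the identity (on the domain of the self-adjoint operator `|X - ξ|²`). -/
def spec [CompleteSpace K] (X : Quantity K m) : Set (EuclideanSpace ℂ (Fin m)) :=
  {ξ | ¬ ∃ R : K →L[ℂ] K, ∀ ψ : (absSq (X.closedShift ξ)).domain,
      R (absSq (X.closedShift ξ) ψ) = ψ}

/-- `X` is the constant quantity `ξ`, i.e. `X j = ξ j • 1` for every component. -/
def IsConst (X : Quantity K m) (ξ : EuclideanSpace ℂ (Fin m)) : Prop :=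
  ∀ (j : Fin m) (ψ : X.domain), X.comp j ψ = ξ j • (ψ : K)

/-- The quantity `X` has in the state `ρ` the expectation `x` (componentwise) and the uncertainty
`σ`, the square root of `⟨|X - x|²⟩`. -/
def HasMeanUncertainty [CompleteSpace K] (X : Quantity K m) (ρ : DensityOperator K)
    (x : EuclideanSpace ℂ (Fin m)) (σ : ℝ) : Prop :=
  (∀ j, HasExpectation ρ (X.closedComp j) (x j)) ∧
    0 ≤ σ ∧ HasAbsSqExpectation ρ (X.closedShift x) (σ ^ 2)

end Quantity

end QuantumSpectrum

end

namespace QuantumSpectrum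

universe u

/-! ### Left inverses of `A*A` and lower bounds for `A`. -/

section Operators

variable {K : Type u} [NormedAddCommGroup K] [InnerProductSpace ℂ K] [CompleteSpace K]
variable {F : Type u} [NormedAddCommGroup F] [InnerProductSpace ℂ F]

/-! Everything rests on one criterion, `mem_spec_iff`: `ξ` is spectral exactly when `X - ξ` is not
bounded below on the original domain. For a closed operator `A`, being bounded below is linked to a
left inverse of `A*A` through the bounded operator `B = (1 + A*A)⁻¹`, whose weak equation replaces
any spectral theorem.

Given the criterion, a spectral point yields unit vectors with `‖(X - ξ)ψ‖` arbitrarily small, and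
their pure states suffice. Conversely, a lower bound `c` for `X - ξ` forces `⟨|X - ξ|²⟩ ≥ c²` in
every state, because `√ρ` has Hilbert–Schmidt norm one. The third claim adds that moving `ξ` to `x`
changes the operator by `‖x - ξ‖` in norm, and that the mean lies within `‖(X - ξ)ψ‖` of `ξ`. -/

theorem mem_domain_of_mem_absSq_domain {A : K →ₗ.[ℂ] F} {ψ : K} (hψ : ψ ∈ (absSq A).domain) :
    ψ ∈ A.domain := by
  obtain ⟨y, -, rfl⟩ := hψ
  exact y.2

theorem inner_absSq_apply {A : K →ₗ.[ℂ] F} (hA : Dense (A.domain : Set K))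
    (ψ : (absSq A).domain) (χ : A.domain) :
    ⟪absSq A ψ, (χ : K)⟫_ℂ = ⟪A ⟨ψ, mem_domain_of_mem_absSq_domain ψ.2⟩, A χ⟫_ℂ := by
  have hmem : A ⟨ψ, mem_domain_of_mem_absSq_domain ψ.2⟩ ∈ A.adjoint.domain := by
    obtain ⟨_, ⟨y, hy, rfl⟩⟩ := ψ
    exact hy
  exact A.adjoint_isFormalAdjoint hA ⟨_, hmem⟩ χ

theorem mem_absSq_domain {A : K →ₗ.[ℂ] F} {ψ : A.domain} {w : K}
    (hw : ∀ χ : A.domain, ⟪w, (χ : K)⟫_ℂ = ⟪A ψ, A χ⟫_ℂ) : (ψ : K) ∈ (absSq A).domain :=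
  ⟨ψ, LinearPMap.mem_adjoint_domain_of_exists _ ⟨w, hw⟩, rfl⟩

theorem absSq_apply_eq {A : K →ₗ.[ℂ] F} (hA : Dense (A.domain : Set K)) {ψ : A.domain} {w : K}
    (hw : ∀ χ : A.domain, ⟪w, (χ : K)⟫_ℂ = ⟪A ψ, A χ⟫_ℂ) :
    absSq A ⟨ψ, mem_absSq_domain hw⟩ = w :=
  hA.eq_of_inner_left ℂ fun v hv => by
    rw [inner_absSq_apply hA _ ⟨v, hv⟩, hw ⟨v, hv⟩]

variable [CompleteSpace F]

/-- The bounded operator `(1 + A*A)⁻¹`, obtained by projecting `K × 0` orthogonally onto the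
graph of the closed operator `A`. -/
theorem exists_one_add_absSq_inverse {A : K →ₗ.[ℂ] F} (hA : A.IsClosed) :
    ∃ (B : K →L[ℂ] K) (h : ∀ φ, B φ ∈ A.domain), ∀ (φ : K) (χ : A.domain),
      ⟪(χ : K), φ⟫_ℂ = ⟪(χ : K), B φ⟫_ℂ + ⟪A χ, A ⟨B φ, h φ⟩⟫_ℂ := by
  let e := WithLp.prodContinuousLinearEquiv 2 ℂ K F
  let G : Submodule ℂ (WithLp 2 (K × F)) := A.graph.comap e.toLinearEquiv.toLinearMap
  have hG : IsClosed (G : Set (WithLp 2 (K × F))) := hA.preimage e.continuous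
  have : CompleteSpace G := hG.completeSpace_coe
  let B : K →L[ℂ] K := ContinuousLinearMap.fst ℂ K F ∘L e.toContinuousLinearMap ∘L
    G.starProjection ∘L e.symm.toContinuousLinearMap ∘L ContinuousLinearMap.inl ℂ K F
  have hmem (φ : K) : e (G.starProjection (e.symm (φ, 0))) ∈ A.graph :=
    G.starProjection_apply_mem (e.symm (φ, 0))
  have hdom (φ : K) : B φ ∈ A.domain := A.mem_domain_of_mem_graph (hmem φ)
  have hval (φ : K) : A ⟨B φ, hdom φ⟩ = (e (G.starProjection (e.symm (φ, 0)))).2 :=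
    A.mem_graph_snd_inj (A.mem_graph ⟨B φ, hdom φ⟩) (hmem φ) rfl
  refine ⟨B, hdom, fun φ χ => ?_⟩
  have hχ : e.symm ((χ : K), A χ) ∈ G := A.mem_graph χ
  -- Orthogonality of the projection residual to the graph is the conjugate of the required weak
  -- equation.
  have horth := Submodule.starProjection_inner_eq_zero (K := G) (e.symm (φ, 0)) _ hχ
  rw [← inner_conj_symm, map_eq_zero, inner_sub_right, sub_eq_zero, WithLp.prod_inner_apply,
    WithLp.prod_inner_apply] at horth
  rw [hval]
  simpa [e, B] using horth

/-- Since `1 - B = A*A B`, the hypothesis gives `R (1 - B) = B`. Then `1 + R` is a left inverse of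
`1 - B`, which is therefore bounded below, and `‖χ - Bχ‖² ≤ ‖Aχ‖ ‖χ‖` transfers this to `A` on its
whole domain. -/
theorem le_norm_of_absSq_leftInverse {A : K →ₗ.[ℂ] F} (hA : A.IsClosed)
    (hd : Dense (A.domain : Set K)) {R : K →L[ℂ] K}
    (hR : ∀ ψ : (absSq A).domain, R (absSq A ψ) = ψ) :
    ∃ c : ℝ, 0 < c ∧ ∀ χ : A.domain, c * ‖(χ : K)‖ ≤ ‖A χ‖ := by
  obtain ⟨B, h, hB⟩ := exists_one_add_absSq_inverse hA
  have hsq (φ : K) : ‖B φ‖ ^ 2 + ‖A ⟨B φ, h φ⟩‖ ^ 2 = RCLike.re ⟪B φ, φ⟫_ℂ := by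
    rw [hB φ ⟨B φ, h φ⟩, map_add, inner_self_eq_norm_sq, inner_self_eq_norm_sq]
  have hle (φ : K) : RCLike.re ⟪B φ, φ⟫_ℂ ≤ ‖B φ‖ * ‖φ‖ := re_inner_le_norm _ _
  have hBle (φ : K) : ‖B φ‖ ≤ ‖φ‖ := by
    have := hsq φ
    have := hle φ
    nlinarith [sq_nonneg ‖A ⟨B φ, h φ⟩‖, norm_nonneg (B φ), norm_nonneg φ]
  have hABle (φ : K) : ‖A ⟨B φ, h φ⟩‖ ≤ ‖φ‖ := by
    refine le_of_sq_le_sq ?_ (norm_nonneg _)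
    nlinarith [hsq φ, hle φ, hBle φ, sq_nonneg ‖B φ‖, norm_nonneg φ]
  have hT (φ : K) : R (φ - B φ) = B φ := by
    have hw (χ : A.domain) : ⟪φ - B φ, (χ : K)⟫_ℂ = ⟪A ⟨B φ, h φ⟩, A χ⟫_ℂ := by
      rw [← inner_conj_symm, inner_sub_right, hB φ χ, add_sub_cancel_left, inner_conj_symm]
    have := hR ⟨B φ, mem_absSq_domain hw⟩
    rwa [absSq_apply_eq hd hw] at this
  have hC (φ : K) : ‖φ‖ ≤ (1 + ‖R‖) * ‖φ - B φ‖ := by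
    calc ‖φ‖ = ‖(φ - B φ) + R (φ - B φ)‖ := by rw [hT]; simp
      _ ≤ ‖φ - B φ‖ + ‖R‖ * ‖φ - B φ‖ := (norm_add_le _ _).trans (by gcongr; exact R.le_opNorm _)
      _ = _ := by ring
  have hpos : 0 < 1 + ‖R‖ := by positivity
  refine ⟨((1 + ‖R‖) ^ 2)⁻¹, by positivity, fun χ => ?_⟩
  -- Expanding the square and using the weak equation leaves `Re ⟪Aχ, ABχ⟫ - ‖ABχ‖²`.
  have h1 : ‖(χ : K) - B χ‖ ^ 2 ≤ ‖A χ‖ * ‖(χ : K)‖ := by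
    have e1 : ‖(χ : K)‖ ^ 2 =
        RCLike.re ⟪(χ : K), B χ⟫_ℂ + RCLike.re ⟪A χ, A ⟨B χ, h χ⟩⟫_ℂ := by
      rw [← map_add, ← hB, inner_self_eq_norm_sq]
    have e2 := norm_sub_sq (𝕜 := ℂ) (χ : K) (B χ)
    have e3 := hsq χ
    have e4 : RCLike.re ⟪B χ, (χ : K)⟫_ℂ = RCLike.re ⟪(χ : K), B χ⟫_ℂ := inner_re_symm _ _
    have e5 : RCLike.re ⟪A χ, A ⟨B χ, h χ⟩⟫_ℂ ≤ ‖A χ‖ * ‖(χ : K)‖ :=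
      (re_inner_le_norm _ _).trans (by gcongr; exact hABle _)
    nlinarith [sq_nonneg ‖A ⟨B χ, h χ⟩‖]
  rw [inv_mul_le_iff₀ (by positivity)]
  rcases (norm_nonneg (χ : K)).eq_or_lt with h0 | h0
  · rw [← h0]; positivity
  · refine le_of_mul_le_mul_right ?_ h0
    calc ‖(χ : K)‖ * ‖(χ : K)‖ ≤ ((1 + ‖R‖) * ‖(χ : K) - B χ‖) * ((1 + ‖R‖) * ‖(χ : K) - B χ‖) := by
          gcongr <;> exact hC _
      _ = (1 + ‖R‖) ^ 2 * ‖(χ : K) - B χ‖ ^ 2 := by ring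
      _ ≤ (1 + ‖R‖) ^ 2 * (‖A χ‖ * ‖(χ : K)‖) := by gcongr
      _ = _ := by ring

/-- The lower bound gives `(1 + c²) ‖Bφ‖² ≤ ‖Bφ‖ ‖φ‖`, so `‖B‖ < 1` and a Neumann series inverts `1
- B`. The left inverse is `B (1 - B)⁻¹`: for `φ = ψ + A*Aψ` one has `Bφ = ψ` and `(1 - B)φ = A*Aψ`.
-/
theorem exists_absSq_leftInverse {A : K →ₗ.[ℂ] F} (hA : A.IsClosed)
    (hd : Dense (A.domain : Set K)) {c : ℝ} (hc : 0 < c)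
    (hAc : ∀ χ : A.domain, c * ‖(χ : K)‖ ≤ ‖A χ‖) :
    ∃ R : K →L[ℂ] K, ∀ ψ : (absSq A).domain, R (absSq A ψ) = ψ := by
  obtain ⟨B, h, hB⟩ := exists_one_add_absSq_inverse hA
  have hnorm : ‖B‖ < 1 := by
    refine (B.opNorm_le_bound (M := (1 + c ^ 2)⁻¹) (by positivity) fun φ => ?_).trans_lt
      (inv_lt_one_of_one_lt₀ (by nlinarith))
    have e1 : ‖B φ‖ ^ 2 + ‖A ⟨B φ, h φ⟩‖ ^ 2 = RCLike.re ⟪B φ, φ⟫_ℂ := by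
      rw [hB φ ⟨B φ, h φ⟩, map_add, inner_self_eq_norm_sq, inner_self_eq_norm_sq]
    have e2 : RCLike.re ⟪B φ, φ⟫_ℂ ≤ ‖B φ‖ * ‖φ‖ := re_inner_le_norm _ _
    have e3 : (c * ‖B φ‖) ^ 2 ≤ ‖A ⟨B φ, h φ⟩‖ ^ 2 := by gcongr; exact hAc ⟨B φ, h φ⟩
    rw [inv_mul_eq_div, le_div_iff₀ (by positivity)]
    rcases (norm_nonneg (B φ)).eq_or_lt with h0 | h0
    · rw [← h0, zero_mul]; positivity
    · nlinarith
  refine ⟨B * ((Units.oneSub B hnorm)⁻¹ : (K →L[ℂ] K)ˣ), fun ψ => ?_⟩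
  let ψ' : A.domain := ⟨ψ, mem_domain_of_mem_absSq_domain ψ.2⟩
  set φ := (ψ : K) + absSq A ψ with hφ
  -- Both vectors solve the same weak equation; testing it on their difference `d` gives `‖d‖² +
  -- ‖Ad‖² = 0`.
  have hBφ : B φ = ψ := by
    let d : A.domain := ⟨B φ, h φ⟩ - ψ'
    have e1 : ⟪(d : K), φ⟫_ℂ = ⟪(d : K), ψ⟫_ℂ + ⟪A d, A ψ'⟫_ℂ := by
      rw [hφ, inner_add_right, ← inner_conj_symm _ (absSq A ψ), inner_absSq_apply hd,
        inner_conj_symm]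
    have e2 : ⟪(d : K), (d : K)⟫_ℂ + ⟪A d, A d⟫_ℂ = 0 := by
      have : A d = A ⟨B φ, h φ⟩ - A ψ' := A.map_sub _ _
      have h3 : ⟪(d : K), (d : K)⟫_ℂ = ⟪(d : K), B φ⟫_ℂ - ⟪(d : K), ψ⟫_ℂ := inner_sub_right _ _ _
      have h4 : ⟪A d, A d⟫_ℂ = ⟪A d, A ⟨B φ, h φ⟩⟫_ℂ - ⟪A d, A ψ'⟫_ℂ :=
        (congrArg (fun y => ⟪A d, y⟫_ℂ) this).trans (inner_sub_right _ _ _)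
      rw [h3, h4]
      linear_combination e1 - hB φ d
    have e3 := congrArg RCLike.re e2
    rw [map_add, inner_self_eq_norm_sq, inner_self_eq_norm_sq, map_zero] at e3
    have e4 : ‖(d : K)‖ = 0 := by nlinarith [sq_nonneg ‖(d : K)‖, sq_nonneg ‖A d‖]
    exact sub_eq_zero.1 (norm_eq_zero.1 e4)
  have h2 : absSq A ψ = ((Units.oneSub B hnorm : (K →L[ℂ] K)ˣ) : K →L[ℂ] K) φ := by
    rw [Units.val_oneSub, sub_apply, one_apply_eq_self, hBφ, hφ, add_sub_cancel_left]
  rw [h2, mul_apply_eq_comp, ← mul_apply_eq_comp (Units.val _), Units.inv_mul, one_apply_eq_self,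
    hBφ]

end Operators

/-! ### Pure states and Hilbert–Schmidt estimates. -/

section States

variable {K : Type u} [NormedAddCommGroup K] [InnerProductSpace ℂ K]
variable {F : Type u} [NormedAddCommGroup F] [InnerProductSpace ℂ F]

/-- The pure state `ψ ψ*` of a unit vector `ψ`. -/
noncomputable def DensityOperator.pure (ψ : K) (hψ : ‖ψ‖ = 1) : DensityOperator K where
  op := InnerProductSpace.rankOne ℂ ψ ψ
  pos := InnerProductSpace.isPositive_rankOne_self ψ
  trace_eq_one ι b := by
    have h := b.hasSum_inner_mul_inner ψ ψ
    rw [inner_self_eq_norm_sq_to_K, hψ] at h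
    simpa [inner_smul_right] using h

variable [CompleteSpace K]

theorem DensityOperator.sqrt_pure_op (ψ : K) (hψ : ‖ψ‖ = 1) :
    CFC.sqrt (DensityOperator.pure ψ hψ).op = (DensityOperator.pure ψ hψ).op :=
  CFC.sqrt_unique (InnerProductSpace.isIdempotentElem_rankOne_self hψ)
    ((ContinuousLinearMap.nonneg_iff_isPositive _).2 (DensityOperator.pure ψ hψ).pos)

theorem DensityOperator.hasSum_norm_sqrt_sq (ρ : DensityOperator K) {ι : Type u}
    (b : HilbertBasis ι ℂ K) : HasSum (fun i => ‖CFC.sqrt ρ.op (b i)‖ ^ 2) 1 := by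
  have hρ : 0 ≤ ρ.op := (ContinuousLinearMap.nonneg_iff_isPositive _).2 ρ.pos
  have hs : (CFC.sqrt ρ.op).IsPositive :=
    (ContinuousLinearMap.nonneg_iff_isPositive _).1 (CFC.sqrt_nonneg _)
  have h := Complex.hasSum_re (ρ.trace_eq_one ι b)
  rw [Complex.one_re] at h
  refine h.congr_fun fun i => ?_
  nth_rewrite 2 [← CFC.sqrt_mul_sqrt_self ρ.op hρ]
  rw [mul_apply_eq_comp]
  exact (inner_self_eq_norm_sq (𝕜 := ℂ) _).symm.trans (congrArg Complex.re (hs.isSymmetric _ _))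

omit [CompleteSpace K] in
theorem hasExpectation_pure {A : K →ₗ.[ℂ] K} (ψ : A.domain) (hψ : ‖(ψ : K)‖ = 1) :
    HasExpectation (DensityOperator.pure (ψ : K) hψ) A ⟪(ψ : K), A ψ⟫_ℂ := by
  refine ⟨fun φ => A.domain.smul_mem _ ψ.2, fun ι b => ?_⟩
  refine (b.hasSum_inner_mul_inner (ψ : K) (A ψ)).congr_fun fun i => ?_
  rw [← inner_smul_right, ← A.map_smul]
  rfl

theorem hasAbsSqExpectation_pure {A : K →ₗ.[ℂ] F} (ψ : A.domain) (hψ : ‖(ψ : K)‖ = 1) :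
    HasAbsSqExpectation (DensityOperator.pure (ψ : K) hψ) A (‖A ψ‖ ^ 2) := by
  refine ⟨fun φ => ?_, fun ι b => ?_⟩
  · rw [DensityOperator.sqrt_pure_op]
    exact A.domain.smul_mem _ ψ.2
  · have h := (Complex.hasSum_re (b.hasSum_inner_mul_inner (ψ : K) ψ)).mul_right (‖A ψ‖ ^ 2)
    have h1 : (⟪(ψ : K), (ψ : K)⟫_ℂ).re = 1 := by
      have := inner_self_eq_norm_sq (𝕜 := ℂ) (ψ : K)
      rw [hψ, one_pow] at this
      exact this
    rw [h1, one_mul] at h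
    refine h.congr_fun fun i => ?_
    have e : A ⟨CFC.sqrt (DensityOperator.pure (ψ : K) hψ).op (b i),
        by rw [DensityOperator.sqrt_pure_op]; exact A.domain.smul_mem _ ψ.2⟩
        = ⟪(ψ : K), b i⟫_ℂ • A ψ := by
      rw [← A.map_smul]
      congr 1
      exact Subtype.ext (congrArg (fun T : K →L[ℂ] K => T (b i))
        (DensityOperator.sqrt_pure_op (ψ : K) hψ))
    rw [e, norm_smul, mul_pow]
    congr 1
    have e2 := inner_mul_symm_re_eq_norm (𝕜 := ℂ) (ψ : K) (b i)
    rw [norm_mul, norm_inner_symm (b i), ← sq] at e2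
    exact e2.symm

theorem HasAbsSqExpectation.sq_le {ρ : DensityOperator K} {A : K →ₗ.[ℂ] F} {v c : ℝ}
    (h : HasAbsSqExpectation ρ A v) (hc : 0 ≤ c)
    (hA : ∀ χ : A.domain, c * ‖(χ : K)‖ ≤ ‖A χ‖) : c ^ 2 ≤ v := by
  obtain ⟨hd, hsum⟩ := h
  obtain ⟨w, b, -⟩ := exists_hilbertBasis ℂ K
  have h1 := (ρ.hasSum_norm_sqrt_sq b).mul_left (c ^ 2)
  rw [mul_one] at h1
  refine hasSum_le (fun i => ?_) h1 (hsum w b)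
  rw [← mul_pow]
  gcongr
  exact hA ⟨_, hd (b i)⟩

end States

/-- The inequality defines a closed set of pairs, so it passes from the graph to its closure. -/
theorem le_norm_closure_apply {E F : Type*} [NormedAddCommGroup E] [NormedSpace ℂ E]
    [NormedAddCommGroup F] [NormedSpace ℂ F] {f : E →ₗ.[ℂ] F} (hf : f.IsClosable) {c : ℝ}
    (h : ∀ ψ : f.domain, c * ‖(ψ : E)‖ ≤ ‖f ψ‖) (ψ : f.closure.domain) :
    c * ‖(ψ : E)‖ ≤ ‖f.closure ψ‖ := by
  have hmem : ((ψ : E), f.closure ψ) ∈ _root_.closure (f.graph : Set (E × F)) := by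
    rw [← Submodule.topologicalClosure_coe, hf.graph_closure_eq_closure_graph]
    exact f.closure.mem_graph ψ
  have hcl : IsClosed {p : E × F | c * ‖p.1‖ ≤ ‖p.2‖} :=
    isClosed_le (by fun_prop) (by fun_prop)
  refine closure_minimal ?_ hcl hmem
  rintro ⟨x, y⟩ hxy
  obtain ⟨z, rfl, rfl⟩ := (LinearPMap.mem_graph_iff f).1 hxy
  exact h z

/-! ### The spectrum of a quantity and its approximating states. -/

namespace Quantity

variable {K : Type u} [NormedAddCommGroup K] [InnerProductSpace ℂ K] {m : ℕ}

theorem shift_apply (X : Quantity K m) (ξ : EuclideanSpace ℂ (Fin m)) (ψ : X.domain) (j : Fin m) :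
    X.shift ξ ψ j = X.comp j ψ - ξ j • (ψ : K) := rfl

theorem isClosable_shift (X : Quantity K m) (ξ : EuclideanSpace ℂ (Fin m)) :
    (X.shift ξ).IsClosable := by
  refine ⟨_, (Submodule.toLinearPMap_graph_eq _ ?_).symm⟩
  rintro ⟨x, y⟩ hxy (rfl : x = 0)
  refine PiLp.ext fun j => ?_
  obtain ⟨f, hf⟩ := X.closable j
  -- Adding `ξ j` times the first entry back carries the graph of `X - ξ` into that of `X j`, so
  -- closability is inherited componentwise.
  let Φ : K × PiLp 2 (fun _ : Fin m => K) → K × K := fun p => (p.1, p.2 j + ξ j • p.1)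
  have hΦ : Continuous Φ := by fun_prop
  have hmaps : Set.MapsTo Φ (X.shift ξ).graph (LinearPMap.mk X.domain (X.comp j)).graph := by
    rintro ⟨x, y⟩ hxy
    obtain ⟨z, rfl, rfl⟩ := (LinearPMap.mem_graph_iff _).1 hxy
    refine (LinearPMap.mem_graph_iff _).2 ⟨z, rfl, ?_⟩
    exact (sub_add_cancel (X.comp j z) (ξ j • (z : K))).symm
  have hmem : Φ (0, y) ∈ f.graph := by
    rw [← hf]
    exact map_mem_closure hΦ hxy hmaps
  have := f.graph_fst_eq_zero_snd hmem rfl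
  simpa using this

theorem norm_shift_sub_shift (X : Quantity K m) (x ξ : EuclideanSpace ℂ (Fin m)) (ψ : X.domain) :
    ‖X.shift x ψ - X.shift ξ ψ‖ = ‖x - ξ‖ * ‖(ψ : K)‖ := by
  refine (sq_eq_sq₀ (norm_nonneg _) (by positivity)).1 ?_
  rw [PiLp.norm_sq_eq_of_L2, mul_pow, EuclideanSpace.norm_sq_eq, Finset.sum_mul]
  refine Finset.sum_congr rfl fun j _ => ?_
  rw [PiLp.sub_apply, shift_apply, shift_apply, sub_sub_sub_cancel_left, ← sub_smul, norm_smul,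
    mul_pow, norm_sub_rev, PiLp.sub_apply]

theorem exists_shift_apply_ne_zero {X : Quantity K m} {ξ : EuclideanSpace ℂ (Fin m)}
    (h : ¬ X.IsConst ξ) : ∃ χ : X.domain, X.shift ξ χ ≠ 0 := by
  contrapose! h
  intro j ψ
  exact sub_eq_zero.1 (congrArg (fun y : PiLp 2 (fun _ : Fin m => K) => y j) (h ψ))

theorem closedShift_apply (X : Quantity K m) (ξ : EuclideanSpace ℂ (Fin m)) (ψ : X.domain) :
    X.closedShift ξ ⟨ψ, (X.shift ξ).le_closure.1 ψ.2⟩ = X.shift ξ ψ :=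
  ((X.shift ξ).le_closure.2 rfl).symm

theorem closedComp_apply (X : Quantity K m) (j : Fin m) (ψ : X.domain) :
    X.closedComp j ⟨ψ, (LinearPMap.mk X.domain (X.comp j)).le_closure.1 ψ.2⟩ = X.comp j ψ :=
  ((LinearPMap.mk X.domain (X.comp j)).le_closure.2 (x := ψ) rfl).symm

theorem exists_unit_vector {X : Quantity K m} {ξ : EuclideanSpace ℂ (Fin m)} {ε : ℝ}
    {φ : X.domain} (h : ‖X.shift ξ φ‖ < ε * ‖(φ : K)‖) :
    ∃ (a : ℂ) (ψ : X.domain), a ≠ 0 ∧ ‖(ψ : K)‖ = 1 ∧ X.shift ξ ψ = a • X.shift ξ φ ∧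
      ‖X.shift ξ ψ‖ < ε := by
  have h0 : 0 < ‖(φ : K)‖ := by
    refine (norm_nonneg _).lt_of_ne' fun h0 => ?_
    rw [h0, mul_zero] at h
    exact (norm_nonneg _).not_gt h
  have ha : ‖((‖(φ : K)‖⁻¹ : ℝ) : ℂ)‖ = ‖(φ : K)‖⁻¹ := by
    rw [Complex.norm_real, norm_inv, norm_norm]
  have hs := (X.shift ξ).map_smul ((‖(φ : K)‖⁻¹ : ℝ) : ℂ) φ
  refine ⟨((‖(φ : K)‖⁻¹ : ℝ) : ℂ), ((‖(φ : K)‖⁻¹ : ℝ) : ℂ) • φ, ?_, ?_, hs, ?_⟩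
  · exact_mod_cast inv_ne_zero h0.ne'
  · rw [Submodule.coe_smul, norm_smul, ha, inv_mul_cancel₀ h0.ne']
  · refine (congrArg norm hs).trans_lt ?_
    rw [norm_smul, ha, inv_mul_lt_iff₀ h0, mul_comm]
    exact h

variable [CompleteSpace K]

theorem mem_spec_iff (X : Quantity K m) (ξ : EuclideanSpace ℂ (Fin m)) :
    ξ ∈ X.spec ↔ ∀ c : ℝ, 0 < c → ∃ ψ : X.domain, ‖X.shift ξ ψ‖ < c * ‖(ψ : K)‖ := by
  have hcl : (X.closedShift ξ).IsClosed := (X.isClosable_shift ξ).closure_isClosed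
  have hd : Dense ((X.closedShift ξ).domain : Set K) :=
    X.dense_domain.mono (X.shift ξ).le_closure.1
  constructor
  · intro h c hc
    by_contra! hb
    exact h (exists_absSq_leftInverse hcl hd hc (le_norm_closure_apply (X.isClosable_shift ξ) hb))
  · rintro h ⟨R, hR⟩
    obtain ⟨c, hc, hb⟩ := le_norm_of_absSq_leftInverse hcl hd hR
    obtain ⟨ψ, hψ⟩ := h c hc
    refine hψ.not_ge ?_
    rw [← closedShift_apply]
    exact hb ⟨ψ, (X.shift ξ).le_closure.1 ψ.2⟩

/-- The centre `x` may vary with `ε`, so that this serves both fixed `ξ` and the mean of the state.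
-/
theorem mem_spec_of_hasAbsSqExpectation {X : Quantity K m} {ξ : EuclideanSpace ℂ (Fin m)}
    (h : ∀ ε : ℝ, 0 < ε → ∃ (ρ : DensityOperator K) (x : EuclideanSpace ℂ (Fin m)) (v : ℝ),
      HasAbsSqExpectation ρ (X.closedShift x) v ∧ v < ε ^ 2 ∧ ‖x - ξ‖ < ε) : ξ ∈ X.spec := by
  rw [mem_spec_iff]
  intro c hc
  by_contra! hb
  -- One half of `c` pays for replacing `ξ` by `x`; the other half remains as a lower bound
  -- contradicting `v < (c / 2)²`.
  obtain ⟨ρ, x, v, hv, hvc, hx⟩ := h (c / 2) (by positivity)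
  refine hvc.not_ge (hv.sq_le (by positivity)
    (le_norm_closure_apply (X.isClosable_shift x) fun ψ => ?_))
  have e1 := X.norm_shift_sub_shift x ξ ψ
  have e2 := norm_sub_norm_le (X.shift ξ ψ) (X.shift x ψ)
  rw [norm_sub_rev] at e2
  have e3 : ‖x - ξ‖ * ‖(ψ : K)‖ ≤ c / 2 * ‖(ψ : K)‖ := by gcongr
  linarith [hb ψ]

theorem exists_unit_vector_of_mem_spec {X : Quantity K m} {ξ : EuclideanSpace ℂ (Fin m)}
    (h : ξ ∈ X.spec) {ε : ℝ} (hε : 0 < ε) :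
    ∃ ψ : X.domain, ‖(ψ : K)‖ = 1 ∧ ‖X.shift ξ ψ‖ < ε := by
  obtain ⟨φ, hφ⟩ := (X.mem_spec_iff ξ).1 h ε hε
  obtain ⟨-, ψ, -, h1, -, h2⟩ := exists_unit_vector hφ
  exact ⟨ψ, h1, h2⟩

theorem exists_unit_vector_of_mem_spec_of_not_isConst {X : Quantity K m}
    {ξ : EuclideanSpace ℂ (Fin m)} (h : ξ ∈ X.spec) (hX : ¬ X.IsConst ξ) {ε : ℝ} (hε : 0 < ε) :
    ∃ ψ : X.domain, ‖(ψ : K)‖ = 1 ∧ 0 < ‖X.shift ξ ψ‖ ∧ ‖X.shift ξ ψ‖ < ε := by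
  obtain ⟨ψ, hψ, hlt⟩ := exists_unit_vector_of_mem_spec h hε
  rcases eq_or_ne (X.shift ξ ψ) 0 with h0 | h0
  swap
  · exact ⟨ψ, hψ, norm_pos_iff.2 h0, hlt⟩
  -- If `ψ` is annihilated, a small nonzero multiple of a vector `χ` outside the kernel is added;
  -- continuity at `t = 0` keeps the strict bound.
  obtain ⟨χ, hχ⟩ := exists_shift_apply_ne_zero hX
  have hs (t : ℂ) : X.shift ξ (ψ + t • χ) = t • X.shift ξ χ :=
    ((X.shift ξ).map_add ψ (t • χ)).trans
      ((congrArg₂ (· + ·) h0 ((X.shift ξ).map_smul t χ)).trans (zero_add _))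
  have hev : ∀ᶠ t : ℂ in nhds 0, ‖t • X.shift ξ χ‖ < ε * ‖(ψ : K) + t • (χ : K)‖ := by
    refine ContinuousAt.eventually_lt (by fun_prop) (by fun_prop) ?_
    simpa [hψ] using hε
  obtain ⟨t, ht, ht0⟩ :=
    ((hev.filter_mono nhdsWithin_le_nhds).and (self_mem_nhdsWithin (s := {(0 : ℂ)}ᶜ))).exists
  obtain ⟨a, ψ', ha, h1, h2, h3⟩ := exists_unit_vector (X := X) (ξ := ξ) (φ := ψ + t • χ)
    (ε := ε) (by rw [hs]; exact ht)
  refine ⟨ψ', h1, ?_, h3⟩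
  rw [h2, hs, norm_pos_iff]
  exact smul_ne_zero ha (smul_ne_zero ht0 hχ)

theorem hasAbsSqExpectation_closedShift_pure (X : Quantity K m) (ξ : EuclideanSpace ℂ (Fin m))
    (ψ : X.domain) (hψ : ‖(ψ : K)‖ = 1) :
    HasAbsSqExpectation (DensityOperator.pure (ψ : K) hψ) (X.closedShift ξ)
      (‖X.shift ξ ψ‖ ^ 2) := by
  rw [← closedShift_apply]
  exact hasAbsSqExpectation_pure (A := X.closedShift ξ) ⟨ψ, (X.shift ξ).le_closure.1 ψ.2⟩ hψ

/-- The componentwise mean value of `X` in the pure state of `ψ`. -/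
noncomputable def pureMean (X : Quantity K m) (ψ : X.domain) : EuclideanSpace ℂ (Fin m) :=
  WithLp.toLp 2 fun j => ⟪(ψ : K), X.comp j ψ⟫_ℂ

theorem hasMeanUncertainty_pure (X : Quantity K m) (ψ : X.domain) (hψ : ‖(ψ : K)‖ = 1) :
    X.HasMeanUncertainty (DensityOperator.pure (ψ : K) hψ) (X.pureMean ψ)
      ‖X.shift (X.pureMean ψ) ψ‖ := by
  refine ⟨fun j => ?_, norm_nonneg _, X.hasAbsSqExpectation_closedShift_pure _ ψ hψ⟩
  change HasExpectation _ _ ⟪(ψ : K), X.comp j ψ⟫_ℂ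
  rw [← closedComp_apply]
  exact hasExpectation_pure (A := X.closedComp j)
    ⟨ψ, (LinearPMap.mk X.domain (X.comp j)).le_closure.1 ψ.2⟩ hψ

omit [CompleteSpace K] in
-- Each entry of the difference is `⟪ψ, (X j - ξ j)ψ⟫`, to which Cauchy–Schwarz applies.
theorem norm_pureMean_sub_le (X : Quantity K m) (ξ : EuclideanSpace ℂ (Fin m)) (ψ : X.domain)
    (hψ : ‖(ψ : K)‖ = 1) : ‖X.pureMean ψ - ξ‖ ≤ ‖X.shift ξ ψ‖ := by
  refine le_of_sq_le_sq ?_ (norm_nonneg _)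
  rw [EuclideanSpace.norm_sq_eq]
  refine le_of_le_of_eq ?_ (PiLp.norm_sq_eq_of_L2 _ (X.shift ξ ψ)).symm
  refine Finset.sum_le_sum fun j _ => ?_
  have e : (X.pureMean ψ - ξ) j = ⟪(ψ : K), X.shift ξ ψ j⟫_ℂ := by
    rw [shift_apply, inner_sub_right, inner_smul_right, inner_self_eq_norm_sq_to_K, hψ]
    simp [pureMean]
  rw [e]
  gcongr
  simpa [hψ] using norm_inner_le_norm (𝕜 := ℂ) (ψ : K) (X.shift ξ ψ j)

omit [CompleteSpace K] in
theorem norm_shift_pureMean_le (X : Quantity K m) (ξ : EuclideanSpace ℂ (Fin m)) (ψ : X.domain)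
    (hψ : ‖(ψ : K)‖ = 1) : ‖X.shift (X.pureMean ψ) ψ‖ ≤ 2 * ‖X.shift ξ ψ‖ := by
  have e1 := X.norm_shift_sub_shift (X.pureMean ψ) ξ ψ
  have e2 := norm_sub_norm_le (X.shift (X.pureMean ψ) ψ) (X.shift ξ ψ)
  have e3 := X.norm_pureMean_sub_le ξ ψ hψ
  rw [hψ, mul_one] at e1
  linarith

end Quantity

end QuantumSpectrum

theorem mainTheorem4 {K : Type*} [NormedAddCommGroup K] [InnerProductSpace ℂ K] [CompleteSpace K]
    {m : ℕ} (X : QuantumSpectrum.Quantity K m) (ξ : EuclideanSpace ℂ (Fin m)) :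
    (ξ ∈ X.spec ↔ ∀ ε : ℝ, 0 < ε → ∃ (ρ : QuantumSpectrum.DensityOperator K) (v : ℝ),
        QuantumSpectrum.HasAbsSqExpectation ρ (X.closedShift ξ) v ∧ v < ε) ∧
    (¬ X.IsConst ξ →
      (ξ ∈ X.spec ↔ ∀ ε : ℝ, 0 < ε → ∃ (ρ : QuantumSpectrum.DensityOperator K) (v : ℝ),
        QuantumSpectrum.HasAbsSqExpectation ρ (X.closedShift ξ) v ∧ 0 < v ∧ v < ε)) ∧
    (ξ ∈ X.spec ↔ ∀ ε : ℝ, 0 < ε → ∃ (ρ : QuantumSpectrum.DensityOperator K)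
        (x : EuclideanSpace ℂ (Fin m)) (σ : ℝ),
        X.HasMeanUncertainty ρ x σ ∧ σ < ε ∧ ‖x - ξ‖ < ε) := by
  have hconv (h : ∀ ε : ℝ, 0 < ε → ∃ (ρ : QuantumSpectrum.DensityOperator K) (v : ℝ),
      QuantumSpectrum.HasAbsSqExpectation ρ (X.closedShift ξ) v ∧ v < ε) : ξ ∈ X.spec := by
    refine QuantumSpectrum.Quantity.mem_spec_of_hasAbsSqExpectation fun ε hε => ?_
    obtain ⟨ρ, v, hv, hlt⟩ := h (ε ^ 2) (by positivity)
    exact ⟨ρ, ξ, v, hv, hlt, by simpa using hε⟩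
  refine ⟨⟨fun h ε hε => ?_, hconv⟩, fun hX => ⟨fun h ε hε => ?_, fun h => hconv fun ε hε => ?_⟩,
    ⟨fun h ε hε => ?_, fun h => ?_⟩⟩
  · obtain ⟨ψ, hψ, hlt⟩ := QuantumSpectrum.Quantity.exists_unit_vector_of_mem_spec h
      (Real.sqrt_pos.2 hε)
    exact ⟨_, _, X.hasAbsSqExpectation_closedShift_pure ξ ψ hψ,
      (Real.lt_sqrt (norm_nonneg _)).1 hlt⟩
  · obtain ⟨ψ, hψ, hpos, hlt⟩ :=
      QuantumSpectrum.Quantity.exists_unit_vector_of_mem_spec_of_not_isConst h hX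
        (Real.sqrt_pos.2 hε)
    exact ⟨_, _, X.hasAbsSqExpectation_closedShift_pure ξ ψ hψ, by positivity,
      (Real.lt_sqrt (norm_nonneg _)).1 hlt⟩
  · obtain ⟨ρ, v, hv, -, hlt⟩ := h ε hε
    exact ⟨ρ, v, hv, hlt⟩
  -- Half of `ε` is needed because recentring at the mean may double the norm.
  · obtain ⟨ψ, hψ, hlt⟩ := QuantumSpectrum.Quantity.exists_unit_vector_of_mem_spec h
      (half_pos hε)
    have h1 := X.norm_pureMean_sub_le ξ ψ hψ
    have h2 := X.norm_shift_pureMean_le ξ ψ hψ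
    exact ⟨_, _, _, X.hasMeanUncertainty_pure ψ hψ, by linarith, by linarith⟩
  · refine QuantumSpectrum.Quantity.mem_spec_of_hasAbsSqExpectation fun ε hε => ?_
    obtain ⟨ρ, x, σ, ⟨-, h0, hσ⟩, hlt, hx⟩ := h ε hε
    exact ⟨ρ, x, _, hσ, by gcongr, hx⟩
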